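/- Let $A$ be a (not necessarily unital) complex $\mathrm{C}^*$-algebra with no 1-dimensional representations, i.e. such that the only $*$-homomorphism $A\to\mathbb{C}$ is zero. For subsets $X,Y\subseteq A$ let $[X,Y]$ denote the (not closed) linear span of the commutators $[x,y]=xy-yx$ with $x\in X$, $y\in Y$, and let $\mathrm{Lin}(X)$ denote the (not closed) linear span of $X$. Let $\mathrm{Ped}(A)$ be the Pedersen ideal of $A$, i.e. its smallest dense two-sided ideal. Let $N_2=\{x\in A : x^2=0\}$ be the set of square-zero elements, let $N_2^c$ be the set of all $x\in A$ for which there are positive elements $e,f\in A$ with $xe=fx=x$ and $ef=0$, and let \[ SN_2^c=\bigcup_{x\in N_2}(1+x)\,N_2^c\,(1-x), \] where $(1+x)a(1-x)=a+xa-ax-xax\in A$. Then \[ \mathrm{Lin}(SN_2^c)=[\mathrm{Ped}(A),\mathrm{Ped}(A)]. \] If in addition $A$ is unital, then $\mathrm{Lin}(N_2)=[A,A]$, and moreover there exists $K\in\mathbb{N}$ (depending only on $A$) such that for all $x,y\in A$ the commutator $[x,y]$ is a sum of at most $K$ square-zero elements of $A$. -/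

import Mathlib

namespace CStarLie

section Algebra

variable {A : Type*} [NonUnitalCStarAlgebra A]

/-- `[X, Y]`: the complex linear span of the commutators `x y - y x` with `x ∈ X` and `y ∈ Y`. -/
def commSpan (X Y : Set A) : Submodule ℂ A :=
  Submodule.span ℂ {c : A | ∃ x ∈ X, ∃ y ∈ Y, c = x * y - y * x}

/-- A linear subspace that absorbs multiplication on both sides (not necessarily closed). -/
def IsIdealSubspace (I : Submodule ℂ A) : Prop :=
  ∀ a : A, ∀ x ∈ I, a * x ∈ I ∧ x * a ∈ I

/-- The Pedersen ideal: the smallest dense two-sided ideal of `A`, given here as the intersection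
of all dense two-sided ideals. -/
def pedersenIdeal (A : Type*) [NonUnitalCStarAlgebra A] : Submodule ℂ A :=
  sInf {I : Submodule ℂ A | IsIdealSubspace I ∧ Dense (I : Set A)}

/-- `A` has no 1-dimensional representations: every `*`-homomorphism from `A` to `ℂ` is zero. -/
def NoOneDimRep (A : Type*) [NonUnitalCStarAlgebra A] : Prop :=
  ∀ π : A →⋆ₙₐ[ℂ] ℂ, π = 0

/-- `A` has a multiplicative unit. -/
def HasUnit (A : Type*) [NonUnitalCStarAlgebra A] : Prop :=
  ∃ u : A, ∀ a : A, u * a = a ∧ a * u = a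

/-- The square zero elements. -/
def N₂ (A : Type*) [NonUnitalCStarAlgebra A] : Set A :=
  {x : A | x * x = 0}

/-- The element `(1 + x) a (1 - x)`, which lies in `A` whether or not `A` has a unit. -/
def conj (x a : A) : A := a + x * a - a * x - x * a * x

/-- In the unitization, `conj x a` is literally `(1 + x) a (1 - x)`. -/
theorem coe_conj (x a : A) :
    ((conj x a : A) : Unitization ℂ A) =
      (1 + (x : Unitization ℂ A)) * (a : Unitization ℂ A) * (1 - (x : Unitization ℂ A)) := by
  simp only [conj, Unitization.inr_add, Unitization.inr_sub, Unitization.inr_mul]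
  noncomm_ring

end Algebra

section Order

variable (A : Type*) [NonUnitalCStarAlgebra A] [PartialOrder A] [StarOrderedRing A]

/-- The elements `x` for which there are positive `e`, `f` with `x e = f x = x` and `e f = 0`. -/
def N₂c : Set A :=
  {x : A | ∃ e f : A, 0 ≤ e ∧ 0 ≤ f ∧ x * e = x ∧ f * x = x ∧ e * f = 0}

/-- The union of the sets `(1 + x) N₂c (1 - x)` over the square zero elements `x`
(zero included). -/
def SN₂c : Set A :=
  {z : A | ∃ x ∈ N₂ A, ∃ a ∈ N₂c A, z = conj x a}

end Order

end CStarLie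

/-!
Write `L` for the span of `SN₂c A`.

*From `L` to commutators.* If `y` is square zero and `z ∈ N₂c A`, the odd and the even part in `y`
of `(1 + y) z (1 - y)` show that `[y, z] ∈ L` and `y z y ∈ L`. Let `z` be square zero. Functional
calculus of `star z * z` and `z * star z` gives two orthogonal increasing sequences of local units,
a `Ladder`, and a cut down element `x` close to `z` that is supported between their lowest terms.
Cutting arbitrary elements of `A` along the ladder, one finds first `[x, a] ∈ L` and then
`[x x⋆ a, b] ∈ L` for all `a, b ∈ A` (`Ladder.sumOf_commutator_mul_mul`). In the second claim there
remain the parts of `a` and `b` outside the two corners; they are reached by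
`y x y` for a square zero element of the form `y = c r` with `r c = 0`
(`sumOf_commutator_of_orthogonal`). Consequently `[J, A] ⊆ L` for the ideal `J = cutIdeal A`
generated by the elements `x x⋆`.

*The ideal `J` is dense.* Its closure `I` contains every square zero element. The quotient norm of
`A / I` then satisfies `‖a ^ n‖ = ‖a‖ ^ n` (`norm_quotient_mk_pow_le`): localizing near the top of
the spectrum of `a⋆ a` produces elements `(1 - g) w` which are square zero and hence vanish modulo
`I`. It follows that `‖a b‖ ≤ ‖b a‖`, and Liouville's theorem shows that `A / I` is commutative
(`commute_of_norm_pow_le`). If it is not zero, Gelfand theory provides a nonzero `*`-homomorphism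
to `ℂ` (`exists_algHom_ne_zero`), which the hypothesis excludes.

*Conclusion.* The Pedersen ideal is contained in the dense ideal `J`, so
`[Ped(A), Ped(A)] ⊆ [J, A] ⊆ L`. Conversely `x ∈ N₂c A` is the commutator of `x` and a function of
its local unit, both of which lie in the Pedersen ideal, and conjugation by `1 + y` is
multiplicative. If `A` is unital, then `J = A`. Writing the unit as a finite sum of generators of
`J` bounds the number of square zero elements needed for a commutator, because every step above
uses a fixed number of them; `SumOf` keeps track of it. Finally a square zero element `z` is the
commutator `[y, |z| ^ (1/2)]` for `y = z |z| ^ (-1/2)` (`exists_eq_commutator_of_mem_N₂`).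
-/

namespace CStarLie

/-! ### Sums of boundedly many elements of a set -/

section SumOf

variable {A : Type*} [NonUnitalCStarAlgebra A]

/-- `v` is a sum of at most `n` elements of `S`. -/
def SumOf (S : Set A) (n : ℕ) (v : A) : Prop :=
  ∃ l : List A, l.length ≤ n ∧ (∀ z ∈ l, z ∈ S) ∧ l.sum = v

namespace SumOf

variable {S : Set A} {m n : ℕ} {u v : A}

theorem of_mem (h : v ∈ S) : SumOf S 1 v := ⟨[v], by simp, by simpa using h, by simp⟩

theorem zero : SumOf S 0 (0 : A) := ⟨[], by simp, by simp, by simp⟩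

theorem mono_set {T : Set A} (hv : SumOf S m v) (h : S ⊆ T) : SumOf T m v := by
  obtain ⟨l, hl, h1, h2⟩ := hv
  exact ⟨l, hl, fun z hz => h (h1 z hz), h2⟩

theorem add (hu : SumOf S m u) (hv : SumOf S n v) : SumOf S (m + n) (u + v) := by
  obtain ⟨l, hl, h1, rfl⟩ := hu
  obtain ⟨l', hl', h1', rfl⟩ := hv
  refine ⟨l ++ l', by simp; omega, fun z hz => ?_, by simp⟩
  rcases List.mem_append.1 hz with h | h
  exacts [h1 z h, h1' z h]

theorem smul (hS : ∀ (c : ℂ), ∀ z ∈ S, c • z ∈ S) (c : ℂ) (hv : SumOf S n v) :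
    SumOf S n (c • v) := by
  obtain ⟨l, hl, h1, rfl⟩ := hv
  refine ⟨l.map (c • ·), by simpa using hl, fun z hz => ?_, by rw [List.smul_sum]⟩
  obtain ⟨w, hw, rfl⟩ := List.mem_map.1 hz
  exact hS c w (h1 w hw)

theorem neg (hS : ∀ (c : ℂ), ∀ z ∈ S, c • z ∈ S) (hv : SumOf S n v) : SumOf S n (-v) := by
  simpa using hv.smul hS (-1)

theorem sub (hS : ∀ (c : ℂ), ∀ z ∈ S, c • z ∈ S) (hu : SumOf S m u) (hv : SumOf S n v) :
    SumOf S (m + n) (u - v) := by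
  rw [sub_eq_add_neg]
  exact hu.add (hv.neg hS)

theorem mem_span (hv : SumOf S n v) : v ∈ Submodule.span ℂ S := by
  obtain ⟨l, -, h1, rfl⟩ := hv
  exact list_sum_mem fun z hz => Submodule.subset_span (h1 z hz)

theorem exists_fin (hv : SumOf S n v) :
    ∃ m : ℕ, m ≤ n ∧ ∃ z : Fin m → A, (∀ i, z i ∈ S) ∧ v = ∑ i, z i := by
  obtain ⟨l, hl, h1, rfl⟩ := hv
  refine ⟨l.length, hl, fun i => l[i], fun i => h1 _ (List.getElem_mem _), ?_⟩
  simp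

end SumOf

end SumOf

/-! ### Conjugation by `1 + x` for square zero `x` -/

section Conj

variable {A : Type*} [NonUnitalCStarAlgebra A]

theorem conj_smul (x a : A) (c : ℂ) : conj x (c • a) = c • conj x a := by
  simp only [conj, smul_sub, smul_add, mul_smul_comm, smul_mul_assoc]

theorem conj_sub (x a b : A) : conj x (a - b) = conj x a - conj x b := by
  simp only [conj]; noncomm_ring

/-- For square zero `x` the element `1 - x` is the inverse of `1 + x`. -/
theorem conj_mul {x : A} (hx : x * x = 0) (a b : A) : conj x (a * b) = conj x a * conj x b := by
  have h : ∀ y, x * (x * y) = 0 := fun y => by rw [← mul_assoc, hx, zero_mul]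
  simp only [conj, mul_add, mul_sub, add_mul, sub_mul, mul_assoc, h, mul_zero]
  abel

theorem neg_mem_N₂ {y : A} (hy : y ∈ N₂ A) : -y ∈ N₂ A := by
  change _ * _ = _
  rw [neg_mul_neg]
  exact hy

end Conj

/-! ### Commutators in the span of `SN₂c` -/

section Moves

variable {A : Type*} [NonUnitalCStarAlgebra A] [PartialOrder A]

theorem smul_mem_N₂c (c : ℂ) {z : A} (hz : z ∈ N₂c A) : c • z ∈ N₂c A := by
  obtain ⟨e, f, he, hf, h1, h2, h3⟩ := hz
  exact ⟨e, f, he, hf, by rw [smul_mul_assoc, h1], by rw [mul_smul_comm, h2], h3⟩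

theorem mul_self_of_mem_N₂c {z : A} (hz : z ∈ N₂c A) : z * z = 0 := by
  obtain ⟨e, f, -, -, h1, h2, h3⟩ := hz
  rw [← h1, mul_assoc, ← h2, ← mul_assoc e, ← mul_assoc e, h3, zero_mul, zero_mul, mul_zero]

theorem smul_mem_SN₂c (c : ℂ) (z : A) (hz : z ∈ SN₂c A) : c • z ∈ SN₂c A := by
  obtain ⟨x, hx, a, ha, rfl⟩ := hz
  exact ⟨x, hx, c • a, smul_mem_N₂c c ha, (conj_smul x a c).symm⟩

theorem SN₂c_subset_N₂ : SN₂c A ⊆ N₂ A := by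
  rintro _ ⟨x, hx, a, ha, rfl⟩
  change _ * _ = _
  rw [← conj_mul hx, mul_self_of_mem_N₂c ha]
  simp [conj]

theorem N₂c_subset_SN₂c : N₂c A ⊆ SN₂c A := fun a ha =>
  ⟨0, by simp [N₂], a, ha, by simp [conj]⟩

theorem sumOf_of_mem_N₂c {z : A} (hz : z ∈ N₂c A) : SumOf (SN₂c A) 1 z :=
  .of_mem (N₂c_subset_SN₂c hz)

theorem conj_mem_SN₂c {y z : A} (hy : y ∈ N₂ A) (hz : z ∈ N₂c A) : conj y z ∈ SN₂c A :=
  ⟨y, hy, z, hz, rfl⟩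

/-- The odd part of `y ↦ (1 + y) z (1 - y)` is the commutator `[y, z]`. -/
theorem sumOf_commutator {y z : A} (hy : y ∈ N₂ A) (hz : z ∈ N₂c A) :
    SumOf (SN₂c A) 2 (y * z - z * y) := by
  have hz' := smul_mem_N₂c (1 / 2) hz
  have h := (SumOf.of_mem (conj_mem_SN₂c hy hz')).sub smul_mem_SN₂c
    (.of_mem (conj_mem_SN₂c (neg_mem_N₂ hy) hz'))
  convert h using 1
  rw [conj_smul, conj_smul, ← smul_sub]
  have : conj y z - conj (-y) z = (2 : ℂ) • (y * z - z * y) := by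
    simp only [conj, two_smul]; noncomm_ring
  rw [this, smul_smul]; norm_num

/-- The even part of `y ↦ (1 + y) z (1 - y)` is `z - y z y`. -/
theorem sumOf_sandwich {y z : A} (hy : y ∈ N₂ A) (hz : z ∈ N₂c A) :
    SumOf (SN₂c A) 3 (y * z * y) := by
  have hz' := smul_mem_N₂c (1 / 2) hz
  have h := (sumOf_of_mem_N₂c hz).sub smul_mem_SN₂c
    ((SumOf.of_mem (conj_mem_SN₂c hy hz')).add (.of_mem (conj_mem_SN₂c (neg_mem_N₂ hy) hz')))
  convert h using 1
  rw [conj_smul, conj_smul, ← smul_add]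
  have : conj y z + conj (-y) z = (2 : ℂ) • (z - y * z * y) := by
    simp only [conj, two_smul]; noncomm_ring
  rw [this, smul_smul]; norm_num

end Moves

/-! ### Ladders of local units -/

section Ladder

variable {A : Type*} [NonUnitalCStarAlgebra A] [PartialOrder A]

/-- Two mutually orthogonal increasing sequences of positive elements in which every later term
is a two-sided unit for the earlier ones. -/
structure Ladder (e f : ℕ → A) : Prop where
  nonneg_left (i : ℕ) : 0 ≤ e i
  nonneg_right (i : ℕ) : 0 ≤ f i
  left_mul_left {i j : ℕ} : i < j → e i * e j = e i
  left_mul_left' {i j : ℕ} : i < j → e j * e i = e i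
  right_mul_right {i j : ℕ} : i < j → f i * f j = f i
  right_mul_right' {i j : ℕ} : i < j → f j * f i = f i
  left_mul_right (i j : ℕ) : e i * f j = 0
  right_mul_left (i j : ℕ) : f i * e j = 0

namespace Ladder

variable {e f : ℕ → A} {x p : A}

theorem symm (h : Ladder e f) : Ladder f e :=
  ⟨h.nonneg_right, h.nonneg_left, h.right_mul_right, h.right_mul_right', h.left_mul_left,
    h.left_mul_left', h.right_mul_left, h.left_mul_right⟩

theorem shift (h : Ladder e f) (k : ℕ) : Ladder (fun i => e (i + k)) (fun i => f (i + k)) :=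
  ⟨fun _ => h.nonneg_left _, fun _ => h.nonneg_right _, fun hij => h.left_mul_left (by omega),
    fun hij => h.left_mul_left' (by omega), fun hij => h.right_mul_right (by omega),
    fun hij => h.right_mul_right' (by omega), fun _ _ => h.left_mul_right _ _,
    fun _ _ => h.right_mul_left _ _⟩

theorem mem_N₂c (h : Ladder e f) {i j : ℕ} (h1 : f i * x = x) (h2 : x * e j = x) : x ∈ N₂c A :=
  ⟨e j, f i, h.nonneg_left j, h.nonneg_right i, h2, h1, h.left_mul_right j i⟩

theorem right_mul_eq (h : Ladder e f) (h1 : f 0 * x = x) (j : ℕ) : f j * x = x := by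
  rcases Nat.eq_zero_or_pos j with rfl | hj
  · exact h1
  · rw [← h1, ← mul_assoc, h.right_mul_right' hj]

theorem left_mul_eq_zero (h : Ladder e f) (h1 : f 0 * x = x) (j : ℕ) : e j * x = 0 := by
  rw [← h1, ← mul_assoc, h.left_mul_right, zero_mul]

theorem mul_left_eq (h : Ladder e f) (h2 : x * e 0 = x) (j : ℕ) : x * e j = x := by
  rcases Nat.eq_zero_or_pos j with rfl | hj
  · exact h2
  · rw [← h2, mul_assoc, h.left_mul_left hj]

theorem mul_right_eq_zero (h : Ladder e f) (h2 : x * e 0 = x) (j : ℕ) : x * f j = 0 := by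
  rw [← h2, mul_assoc, h.left_mul_right, mul_zero]

/-- Commutators with an element supported in the corner `f 0 A e 0`: the other factor is cut along
the ladder into one piece of `N₂c` and two square zero pieces. -/
theorem sumOf_commutator (h : Ladder e f) (h1 : f 0 * x = x) (h2 : x * e 0 = x) (a : A) :
    SumOf (SN₂c A) 8 (x * a - a * x) := by
  have X1 := h.right_mul_eq h1
  have X2 := h.left_mul_eq_zero h1
  have X3 := h.mul_left_eq h2
  have X4 := h.mul_right_eq_zero h2
  have X1' : ∀ j y, f j * (x * y) = x * y := fun j y => by rw [← mul_assoc, X1]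
  have X3' : ∀ j y, x * (e j * y) = x * y := fun j y => by rw [← mul_assoc, X3]
  have X4' : ∀ j y, x * (f j * y) = 0 := fun j y => by rw [← mul_assoc, X4, zero_mul]
  have E21 : e 2 * e 1 = e 1 := h.left_mul_left' (by norm_num)
  have F12 : f 1 * f 2 = f 1 := h.right_mul_right (by norm_num)
  have E21' : ∀ y, e 2 * (e 1 * y) = e 1 * y := fun y => by rw [← mul_assoc, E21]
  have F12' : ∀ y, f 1 * (f 2 * y) = f 1 * y := fun y => by rw [← mul_assoc, F12]
  have FE : ∀ i j y, f i * (e j * y) = 0 := fun i j y => by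
    rw [← mul_assoc, h.right_mul_left, zero_mul]
  have hx : x ∈ N₂c A := h.mem_N₂c h1 h2
  -- the corner of `a` opposite to `x`
  have m1 : e 1 * a * f 1 ∈ N₂ A := by
    change _ * _ = _
    simp only [mul_assoc, FE, mul_zero]
  -- the two pieces of `a` with one leg outside of both corners
  have m2 : e 1 * a - e 1 * a * f 1 - e 1 * a * e 2 ∈ N₂ A := by
    change _ * _ = _
    simp only [mul_sub, sub_mul, mul_assoc, FE, E21', mul_zero]
    abel
  have m3 : a * f 1 - e 1 * a * f 1 - f 2 * a * f 1 ∈ N₂ A := by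
    change _ * _ = _
    simp only [mul_sub, sub_mul, mul_assoc, FE, F12', mul_zero]
    abel
  have m4 : x * a * e 2 ∈ N₂c A := h.mem_N₂c (i := 0) (j := 3) (by simp only [mul_assoc, X1'])
    (by rw [mul_assoc, h.left_mul_left (by norm_num)])
  have m5 : f 2 * a * x ∈ N₂c A := h.mem_N₂c (i := 3) (j := 0)
    (by rw [← mul_assoc, ← mul_assoc, h.right_mul_right' (by norm_num)]) (by rw [mul_assoc, h2])
  have key := ((((CStarLie.sumOf_commutator m1 hx).neg smul_mem_SN₂c).add
    ((CStarLie.sumOf_commutator m2 hx).neg smul_mem_SN₂c)).add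
    ((CStarLie.sumOf_commutator m3 hx).neg smul_mem_SN₂c)).add
    ((sumOf_of_mem_N₂c m4).sub smul_mem_SN₂c (sumOf_of_mem_N₂c m5))
  convert key using 1
  simp only [mul_sub, sub_mul, mul_assoc, X1, X2, X3', X4', mul_zero]
  abel

/-- By `[x p, b] = [x, p b] + [p, b x]` the previous bound passes to products of elements of
opposite corners. -/
theorem sumOf_commutator_mul (h : Ladder e f) (h1 : f 0 * x = x) (h2 : x * e 0 = x)
    (h3 : e 0 * p = p) (h4 : p * f 0 = p) (b : A) :
    SumOf (SN₂c A) 16 (x * p * b - b * (x * p)) := by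
  have key := (h.sumOf_commutator h1 h2 (p * b)).add (h.symm.sumOf_commutator h3 h4 (b * x))
  convert key using 1
  simp only [mul_assoc]
  abel

end Ladder

/-- With `r = g ± q` and `c = p + b ∓ q b` one has `r c = 0`, so that `c r` is square zero and
`(c r) x (c r) = (p + b ∓ q b) x p (g ± q)`. The part of the latter that is odd in the sign gives
the claim. -/
theorem sumOf_odd_part {g x p q b : A} (hx : x ∈ N₂c A) (gx : g * x = x) (pg : p * g = p)
    (gp : g * p = 0) (qx : q * x = 0) (qp : q * p = 0) (gq : g * q = q) (qq : q * q = 0)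
    (gb : g * b = 0) (xb : x * b = 0) (xq : x * q = 0) :
    SumOf (SN₂c A) 6 (p * x * p * q + b * x * p * q - q * b * x * p) := by
  have gp' : ∀ y, g * (p * y) = 0 := fun y => by rw [← mul_assoc, gp, zero_mul]
  have qp' : ∀ y, q * (p * y) = 0 := fun y => by rw [← mul_assoc, qp, zero_mul]
  have gq' : ∀ y, g * (q * y) = q * y := fun y => by rw [← mul_assoc, gq]
  have qq' : ∀ y, q * (q * y) = 0 := fun y => by rw [← mul_assoc, qq, zero_mul]
  have gb' : ∀ y, g * (b * y) = 0 := fun y => by rw [← mul_assoc, gb, zero_mul]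
  have xb' : ∀ y, x * (b * y) = 0 := fun y => by rw [← mul_assoc, xb, zero_mul]
  have xq' : ∀ y, x * (q * y) = 0 := fun y => by rw [← mul_assoc, xq, zero_mul]
  have m1 : (p + b - q * b) * (g + q) ∈ N₂ A := by
    change _ * _ = _
    simp only [mul_sub, sub_mul, mul_add, add_mul, mul_assoc, gp', qp', gq', qq', gb', mul_zero]
    abel
  have m2 : (p + b + q * b) * (g - q) ∈ N₂ A := by
    change _ * _ = _
    simp only [mul_sub, sub_mul, mul_add, add_mul, mul_assoc, gp', qp', gq', qq', gb', mul_zero]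
    abel
  have key := ((sumOf_sandwich m1 (smul_mem_N₂c (1 / 2) hx)).sub smul_mem_SN₂c
    (sumOf_sandwich m2 (smul_mem_N₂c (1 / 2) hx)))
  convert key using 1
  simp only [mul_smul_comm, smul_mul_assoc, ← smul_sub]
  rw [one_div, eq_inv_smul_iff₀ two_ne_zero, two_smul]
  simp only [mul_sub, sub_mul, mul_add, add_mul, mul_assoc, gx, qx, xb', xq', pg,
    mul_zero, zero_mul]
  abel

/-- Under the same hypotheses the commutator `[b x p, q]` is a sum of elements of `SN₂c`. -/
theorem sumOf_commutator_of_orthogonal {g x p q b : A} (hx : x ∈ N₂c A) (gx : g * x = x)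
    (pg : p * g = p) (gp : g * p = 0) (qx : q * x = 0) (qp : q * p = 0) (gq : g * q = q)
    (qq : q * q = 0) (gb : g * b = 0) (xb : x * b = 0) (xq : x * q = 0) :
    SumOf (SN₂c A) 12 (b * x * p * q - q * b * x * p) := by
  have key := (sumOf_odd_part hx gx pg gp qx qp gq qq gb xb xq).sub smul_mem_SN₂c
    (sumOf_odd_part hx gx pg gp qx qp gq qq (mul_zero g) (mul_zero x) xq)
  convert key using 1
  simp only [mul_zero, zero_mul]
  abel

/-- Commutators with the right ideal generated by `x p`, where `x` lies in `f 0 A e 0` and `p`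
in `e 0 A f 0`. The cofactors `a` and `b` are cut along the ladder; the pieces lying outside of
both corners are dealt with by `sumOf_commutator_of_orthogonal`. -/
theorem Ladder.sumOf_commutator_mul_mul {e f : ℕ → A} {x p : A} (h : Ladder e f)
    (h1 : f 0 * x = x) (h2 : x * e 0 = x) (h3 : e 0 * p = p) (h4 : p * f 0 = p) (a b : A) :
    SumOf (SN₂c A) 76 (x * p * a * b - b * (x * p * a)) := by
  have X1 := h.right_mul_eq h1
  have X2 := h.left_mul_eq_zero h1
  have X3 := h.mul_left_eq h2
  have X4 := h.mul_right_eq_zero h2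
  have X1' : ∀ j y, f j * (x * y) = x * y := fun j y => by rw [← mul_assoc, X1]
  have X3' : ∀ j y, x * (e j * y) = x * y := fun j y => by rw [← mul_assoc, X3]
  have X4' : ∀ j y, x * (f j * y) = 0 := fun j y => by rw [← mul_assoc, X4, zero_mul]
  have P1 := h.symm.right_mul_eq h3
  have P2 := h.symm.left_mul_eq_zero h3
  have P3 := h.symm.mul_left_eq h4
  have P1' : ∀ j y, e j * (p * y) = p * y := fun j y => by rw [← mul_assoc, P1]
  have P3' : ∀ j y, p * (f j * y) = p * y := fun j y => by rw [← mul_assoc, P3]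
  have E23 : e 2 * e 3 = e 2 := h.left_mul_left (by norm_num)
  have F21 : f 2 * f 1 = f 1 := h.right_mul_right' (by norm_num)
  have F23 : f 2 * f 3 = f 2 := h.right_mul_right (by norm_num)
  have F21' : ∀ y, f 2 * (f 1 * y) = f 1 * y := fun y => by rw [← mul_assoc, F21]
  have F23' : ∀ y, f 2 * (f 3 * y) = f 2 * y := fun y => by rw [← mul_assoc, F23]
  have EF : ∀ i j y, e i * (f j * y) = 0 := fun i j y => by
    rw [← mul_assoc, h.left_mul_right, zero_mul]
  have FE : ∀ i j y, f i * (e j * y) = 0 := fun i j y => by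
    rw [← mul_assoc, h.right_mul_left, zero_mul]
  have hx : x ∈ N₂c A := h.mem_N₂c h1 h2
  -- the pieces of `a` and `b` with one leg outside of both corners
  obtain ⟨q, hq⟩ : ∃ q, q = f 1 * a - f 1 * a * f 2 - f 1 * a * e 2 := ⟨_, rfl⟩
  obtain ⟨c, hc⟩ : ∃ c, c = b - f 3 * b - e 3 * b := ⟨_, rfl⟩
  -- `s1`, `s2`, `s3` treat the pieces of `[x p a, b] - [q, b x p]`, `s4`, `s5`, `s6` those of
  -- `[q, b x p]`
  have s1 : SumOf (SN₂c A) 8 (x * p * a * e 2 * b - b * (x * p * a * e 2)) :=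
    (h.shift 3).sumOf_commutator (by simp only [mul_assoc, X1'])
      (by simp only [mul_assoc, zero_add, E23]) b
  have s2 : SumOf (SN₂c A) 16 (x * (p * a * f 2) * b - b * (x * (p * a * f 2))) :=
    (h.shift 3).sumOf_commutator_mul (X1 _) (X3 _) (by simp only [mul_assoc, P1'])
      (by simp only [mul_assoc, zero_add, F23]) b
  have s3 := h.sumOf_commutator_mul h1 h2 h3 h4 (q * b)
  have s4 : SumOf (SN₂c A) 16 (f 3 * b * x * p * q - q * (f 3 * b * x * p)) :=
    (h.shift 4).sumOf_commutator_mul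
      (by simp only [← mul_assoc, zero_add, h.right_mul_right' (show 3 < 4 by norm_num)])
      (by simp only [mul_assoc, X3]) (P1 _) (P3 _) q
  have s5 : SumOf (SN₂c A) 8 (e 3 * b * x * p * q - q * (e 3 * b * x * p)) :=
    (h.shift 4).symm.sumOf_commutator
      (by simp only [← mul_assoc, zero_add, h.left_mul_left' (show 3 < 4 by norm_num)])
      (by simp only [mul_assoc, P3]) q
  have s6 : SumOf (SN₂c A) 12 (c * x * p * q - q * c * x * p) := by
    refine sumOf_commutator_of_orthogonal (g := f 2) hx (X1 2) (P3 2) (P2 2) ?_ ?_ ?_ ?_ ?_ ?_ ?_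
    · simp only [hq, sub_mul, mul_assoc, X1, X2, mul_zero]; abel
    · simp only [hq, sub_mul, mul_assoc, P1, P2, mul_zero]; abel
    · simp only [hq, mul_sub, mul_assoc, F21']
    · simp only [hq, sub_mul, mul_sub, mul_assoc, F21', EF, mul_zero]; abel
    · simp only [hc, mul_sub, F23', FE]; abel
    · simp only [hc, mul_sub, X4', X3']; abel
    · simp only [hq, mul_sub, mul_assoc, X4']; abel
  have key := ((((s1.add s2).add s3).sub smul_mem_SN₂c s4).sub smul_mem_SN₂c s5).sub
    smul_mem_SN₂c s6
  convert key using 1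
  have t1 : x * p * q = x * p * a - x * p * a * f 2 - x * p * a * e 2 := by
    simp only [hq, mul_sub, mul_assoc, P3']
  have t2 : c * x * p * q - q * c * x * p = b * (x * p * q) - f 3 * b * x * p * q
      - e 3 * b * x * p * q - (q * (b * (x * p)) - q * (f 3 * b * x * p)
      - q * (e 3 * b * x * p)) := by
    simp only [hc, mul_sub, sub_mul, mul_assoc]
  rw [t2, ← mul_assoc (x * p) q b, t1]
  simp only [mul_sub, sub_mul, mul_assoc]
  abel

end Ladder

/-! ### Ramp functions -/

section Ramp

/-- The continuous function that is `0` on `(-∞, α]`, `1` on `[β, ∞)` and affine in between. -/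
noncomputable def ramp (α β t : ℝ) : ℝ := min 1 (max 0 ((t - α) / (β - α)))

variable {α β t : ℝ}

@[fun_prop]
theorem continuous_ramp (α β : ℝ) : Continuous (ramp α β) := by
  unfold ramp; fun_prop

theorem ramp_nonneg : 0 ≤ ramp α β t := le_min zero_le_one (le_max_left _ _)

theorem ramp_le_one : ramp α β t ≤ 1 := min_le_left _ _

theorem ramp_eq_zero (h : α < β) (ht : t ≤ α) : ramp α β t = 0 := by
  have : (t - α) / (β - α) ≤ 0 := div_nonpos_of_nonpos_of_nonneg (by linarith) (by linarith)
  rw [ramp, max_eq_left this, min_eq_right zero_le_one]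

theorem ramp_eq_one (h : α < β) (ht : β ≤ t) : ramp α β t = 1 := by
  have : 1 ≤ (t - α) / (β - α) := by rw [le_div_iff₀ (by linarith)]; linarith
  exact min_eq_left (this.trans (le_max_right _ _))

theorem ramp_zero (hα : 0 ≤ α) (h : α < β) : ramp α β 0 = 0 := ramp_eq_zero h hα

/-- A ramp vanishing near zero is a multiple of the identity function. -/
theorem ramp_div_max_mul (hα : 0 < α) (h : α < β) (t : ℝ) :
    ramp α β t / max t α * t = ramp α β t := by
  rcases le_total t α with ht | ht
  · rw [ramp_eq_zero h ht]; simp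
  · rw [max_eq_left ht, div_mul_cancel₀ _ (by linarith)]

theorem continuous_ramp_div_max (hα : 0 < α) : Continuous fun t => ramp α β t / max t α :=
  (continuous_ramp α β).div (by fun_prop) fun _ => (lt_max_of_lt_right hα).ne'

end Ramp

/-! ### Ladders from functional calculus -/

section FunctionalCalculus

variable {A : Type*} [NonUnitalCStarAlgebra A]

theorem cfcₙ_ramp_eq_mul {α β : ℝ} (hα : 0 < α) (h : α < β) (c : A) (hc : IsSelfAdjoint c) :
    cfcₙ (ramp α β) c = cfcₙ (fun t => ramp α β t / max t α) c * c ∧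
      cfcₙ (ramp α β) c = c * cfcₙ (fun t => ramp α β t / max t α) c := by
  have h0 : ramp α β 0 / max 0 α = 0 := by simp [ramp_zero hα.le h]
  have hcont := (continuous_ramp_div_max (β := β) hα).continuousOn (s := quasispectrum ℝ c)
  have hid : cfcₙ (fun t : ℝ => t) c = c := cfcₙ_id' ℝ c hc
  have h1 := cfcₙ_mul _ (fun t : ℝ => t) c hcont h0 (by fun_prop) rfl
  have h2 := cfcₙ_mul (fun t : ℝ => t) _ c (by fun_prop) rfl hcont h0
  rw [hid] at h1 h2
  rw [← h1, ← h2]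
  simp only [mul_comm _ (_ / _), ramp_div_max_mul hα h, and_self]

theorem norm_cfcₙ_ramp_le (α β : ℝ) (c : A) : ‖cfcₙ (ramp α β) c‖ ≤ 1 :=
  norm_cfcₙ_le fun t _ => by
    rw [Real.norm_of_nonneg ramp_nonneg]; exact ramp_le_one

/-- The `i`-th term of the ladder below the positive element `c`, starting at height `δ`. -/
noncomputable def rung (δ : ℝ) (c : A) (i : ℕ) : A := cfcₙ (ramp (δ / 2 ^ (i + 1)) (δ / 2 ^ i)) c

theorem rung_lt {δ : ℝ} (hδ : 0 < δ) (i : ℕ) : δ / 2 ^ (i + 1) < δ / 2 ^ i := by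
  rw [pow_succ, ← div_div]
  exact half_lt_self (by positivity)

theorem rung_mul_rung {δ : ℝ} (hδ : 0 < δ) (c : A) {i j : ℕ} (hij : i < j) :
    rung δ c i * rung δ c j = rung δ c i ∧ rung δ c j * rung δ c i = rung δ c i := by
  have hi := rung_lt hδ i
  have hj := rung_lt hδ j
  have hi0 := ramp_zero (by positivity) hi
  have hj0 := ramp_zero (by positivity) hj
  have hle : δ / 2 ^ j ≤ δ / 2 ^ (i + 1) :=
    div_le_div_of_nonneg_left hδ.le (by positivity) (pow_le_pow_right₀ one_le_two hij)
  have key : ∀ t, ramp (δ / 2 ^ (i + 1)) (δ / 2 ^ i) t * ramp (δ / 2 ^ (j + 1)) (δ / 2 ^ j) t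
      = ramp (δ / 2 ^ (i + 1)) (δ / 2 ^ i) t := fun t => by
    rcases le_total t (δ / 2 ^ (i + 1)) with ht | ht
    · rw [ramp_eq_zero hi ht, zero_mul]
    · rw [ramp_eq_one hj (hle.trans ht), mul_one]
  simp only [rung]
  rw [← cfcₙ_mul _ _ c (by fun_prop) hi0 (by fun_prop) hj0,
    ← cfcₙ_mul _ _ c (by fun_prop) hj0 (by fun_prop) hi0]
  simp only [mul_comm (ramp (δ / 2 ^ (j + 1)) (δ / 2 ^ j) _), key, and_self]

theorem isSelfAdjoint_rung (δ : ℝ) (c : A) (i : ℕ) : IsSelfAdjoint (rung δ c i) :=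
  cfcₙ_predicate _ c

/-- The square zero element `z` with the parts of `star z * z` and `z * star z` below height `δ`
cut off. -/
noncomputable def cut (δ : ℝ) (z : A) : A :=
  rung δ (z * star z) 1 * z * rung δ (star z * z) 1

variable [PartialOrder A] [StarOrderedRing A]

/-- Since `star z * z` is the square of the modulus of `z`, right multiplication of `z` by a
function of the modulus is estimated by the supremum of a function of a real variable. -/
theorem norm_smul_sub_mul_cfcₙ_le {g : ℝ → ℝ} (hg : Continuous g) (hg0 : g 0 = 0) (z : A)
    {k C : ℝ} (hC : 0 ≤ C) (h : ∀ t, 0 ≤ t → √t * |k - g t| ≤ C) :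
    ‖k • z - z * cfcₙ g (star z * z)‖ ≤ C := by
  set c := star z * z with hc_def
  have hc : IsSelfAdjoint c := .star_mul_self z
  set e := cfcₙ g c with he
  have hes : star e = e := (cfcₙ_predicate g c : IsSelfAdjoint e)
  have hid : cfcₙ (fun t : ℝ => t) c = c := cfcₙ_id' ℝ c hc
  have h1 : star (k • z - z * e) * (k • z - z * e) = cfcₙ (fun t => (k ^ 2) • t - k • (t * g t)
      - k • (g t * t) + g t * t * g t) c := by
    rw [cfcₙ_add _ _ c (by fun_prop) (by simp) (by fun_prop) (by simp),
      cfcₙ_sub _ _ c (by fun_prop) (by simp) (by fun_prop) (by simp),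
      cfcₙ_sub _ _ c (by fun_prop) (by simp) (by fun_prop) (by simp),
      cfcₙ_smul _ _ c (by fun_prop) rfl, cfcₙ_smul _ _ c (by fun_prop) (by simp),
      cfcₙ_smul _ _ c (by fun_prop) (by simp),
      cfcₙ_mul _ _ c (by fun_prop) rfl (by fun_prop) hg0,
      cfcₙ_mul _ _ c (by fun_prop) (by simp) (by fun_prop) hg0,
      cfcₙ_mul _ _ c (by fun_prop) hg0 (by fun_prop) rfl, hid, ← he]
    rw [star_sub, star_mul, star_smul, hes, hc_def, star_trivial]
    simp only [sub_mul, mul_sub, smul_mul_assoc, mul_smul_comm, mul_assoc, sq, mul_smul, smul_sub]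
    abel
  refine le_of_sq_le_sq ?_ hC
  rw [sq, ← CStarRing.norm_star_mul_self, h1]
  refine norm_cfcₙ_le fun t ht => ?_
  have ht0 : 0 ≤ t := quasispectrum_nonneg_of_nonneg c (star_mul_self_nonneg z) t ht
  have h2 : (k ^ 2) • t - k • (t * g t) - k • (g t * t) + g t * t * g t
      = (√t * |k - g t|) ^ 2 := by
    rw [mul_pow, sq_abs, Real.sq_sqrt ht0]; simp only [smul_eq_mul]; ring
  rw [h2, Real.norm_of_nonneg (by positivity)]
  exact pow_le_pow_left₀ (by positivity) (h t ht0) 2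

/-- Cutting off the part of `star z * z` below `β` changes `z` by at most `√β`. -/
theorem norm_sub_mul_cfcₙ_ramp_le {α β : ℝ} (hα : 0 ≤ α) (h : α < β) (z : A) :
    ‖z - z * cfcₙ (ramp α β) (star z * z)‖ ≤ √β := by
  have := norm_smul_sub_mul_cfcₙ_le (k := 1) (continuous_ramp α β) (ramp_zero hα h) z
    (Real.sqrt_nonneg β) fun t ht => ?_
  · rwa [one_smul] at this
  · rw [abs_of_nonneg (sub_nonneg.2 ramp_le_one)]
    rcases le_total β t with hb | hb
    · rw [ramp_eq_one h hb, sub_self, mul_zero]; positivity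
    · have h1 : 1 - ramp α β t ≤ 1 := sub_le_self _ ramp_nonneg
      exact (mul_le_of_le_one_right (Real.sqrt_nonneg t) h1).trans (Real.sqrt_le_sqrt hb)

theorem ladder_rung {δ : ℝ} (hδ : 0 < δ) {c d : A} (hc : 0 ≤ c) (hd : 0 ≤ d) (hcd : c * d = 0) :
    Ladder (rung δ c) (rung δ d) := by
  have hdc : d * c = 0 := by
    have := congrArg star hcd
    rwa [star_mul, star_zero, hc.isSelfAdjoint.star_eq, hd.isSelfAdjoint.star_eq] at this
  have key : ∀ {c d : A}, 0 ≤ c → 0 ≤ d → c * d = 0 → ∀ i j, rung δ c i * rung δ d j = 0 := by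
    intro c d hc hd hcd i j
    rw [rung, rung, (cfcₙ_ramp_eq_mul (by positivity) (rung_lt hδ i) c hc.isSelfAdjoint).1,
      (cfcₙ_ramp_eq_mul (by positivity) (rung_lt hδ j) d hd.isSelfAdjoint).2, mul_assoc,
      ← mul_assoc c, hcd, zero_mul, mul_zero]
  exact ⟨fun i => cfcₙ_nonneg fun _ _ => ramp_nonneg, fun i => cfcₙ_nonneg fun _ _ => ramp_nonneg,
    fun h => (rung_mul_rung hδ c h).1, fun h => (rung_mul_rung hδ c h).2,
    fun h => (rung_mul_rung hδ d h).1, fun h => (rung_mul_rung hδ d h).2,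
    key hc hd hcd, key hd hc hdc⟩

theorem norm_sub_cut_le {δ : ℝ} (hδ : 0 < δ) (z : A) : ‖z - cut δ z‖ ≤ 2 * √δ := by
  have hlt := rung_lt hδ 1
  have hle : δ / 2 ^ 1 ≤ δ := by simp; linarith
  have h1 : ‖z - z * rung δ (star z * z) 1‖ ≤ √δ :=
    (norm_sub_mul_cfcₙ_ramp_le (by positivity) hlt z).trans (Real.sqrt_le_sqrt hle)
  have h2 : ‖z - rung δ (z * star z) 1 * z‖ ≤ √δ := by
    have := (norm_sub_mul_cfcₙ_ramp_le (by positivity) hlt (star z)).trans (Real.sqrt_le_sqrt hle)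
    rw [star_star] at this
    rwa [← norm_star, star_sub, star_mul, (isSelfAdjoint_rung _ _ _).star_eq]
  have h3 : z - cut δ z = (z - z * rung δ (star z * z) 1)
      + (z - rung δ (z * star z) 1 * z) * rung δ (star z * z) 1 := by
    rw [cut]; noncomm_ring
  rw [h3, two_mul]
  refine (norm_add_le _ _).trans (add_le_add h1 ((norm_mul_le _ _).trans ?_))
  exact (mul_le_of_le_one_right (norm_nonneg _) (norm_cfcₙ_ramp_le _ _ _)).trans h2

/-- Commutators with the right ideal generated by `cut δ z * star (cut δ z)`. -/
theorem sumOf_commutator_cut {δ : ℝ} (hδ : 0 < δ) {z : A} (hz : z ∈ N₂ A) (a b : A) :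
    SumOf (SN₂c A) 76 (cut δ z * star (cut δ z) * a * b - b * (cut δ z * star (cut δ z) * a)) := by
  have hzz : z * z = 0 := hz
  have h0 : star z * z * (z * star z) = 0 := by
    rw [mul_assoc, ← mul_assoc z z, hzz, zero_mul, mul_zero]
  have hl := (ladder_rung hδ (star_mul_self_nonneg z) (mul_star_self_nonneg z) h0).shift 2
  have hs : star (cut δ z) = rung δ (star z * z) 1 * star z * rung δ (z * star z) 1 := by
    rw [cut, star_mul, star_mul, (isSelfAdjoint_rung _ _ _).star_eq,
      (isSelfAdjoint_rung _ _ _).star_eq, mul_assoc]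
  refine hl.sumOf_commutator_mul_mul ?_ ?_ ?_ ?_ a b
  · rw [cut, ← mul_assoc, ← mul_assoc, (rung_mul_rung hδ _ (by norm_num)).2]
  · rw [cut, mul_assoc, (rung_mul_rung hδ _ (by norm_num)).1]
  · rw [hs, ← mul_assoc, ← mul_assoc, (rung_mul_rung hδ _ (by norm_num)).2]
  · rw [hs, mul_assoc, (rung_mul_rung hδ _ (by norm_num)).1]

end FunctionalCalculus

/-! ### Quotients of Banach algebras -/

section BanachQuotient

variable {R : Type*} [NormedRing R] (I : Ideal R) [I.IsTwoSided] [IsClosed (I : Set R)]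

/-- The quotient of a normed ring by a closed two-sided ideal is a normed ring. -/
noncomputable instance quotientNormedRing : NormedRing (R ⧸ I) :=
  { Ideal.Quotient.ring I, Submodule.Quotient.normedAddCommGroup I with
    norm_mul_le := fun x y => by
      refine le_of_forall_pos_lt_add fun ε hε => ?_
      have hc : Filter.Tendsto (fun r : ℝ => (‖x‖ + r) * (‖y‖ + r)) (nhdsWithin 0 (Set.Ioi 0))
          (nhds (‖x‖ * ‖y‖)) := by
        have : Continuous fun r : ℝ => (‖x‖ + r) * (‖y‖ + r) := by fun_prop
        simpa using (this.tendsto 0).mono_left nhdsWithin_le_nhds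
      obtain ⟨r, hr, hr0⟩ := ((hc.eventually (gt_mem_nhds (lt_add_of_pos_right _ hε))).and
        self_mem_nhdsWithin).exists
      obtain ⟨a, rfl, ha⟩ := Submodule.Quotient.norm_mk_lt x hr0
      obtain ⟨b, rfl, hb⟩ := Submodule.Quotient.norm_mk_lt y hr0
      calc _ ≤ ‖a * b‖ := Submodule.Quotient.norm_mk_le I (a * b)
        _ ≤ ‖a‖ * ‖b‖ := norm_mul_le a b
        _ ≤ _ := mul_le_mul ha.le hb.le (norm_nonneg _) ((norm_nonneg _).trans ha.le)
        _ < _ := hr }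

/-- The quotient of a Banach algebra by a closed two-sided ideal is a normed algebra. -/
noncomputable instance quotientNormedAlgebra [NormedAlgebra ℂ R] : NormedAlgebra ℂ (R ⧸ I) :=
  { toAlgebra := Ideal.Quotient.algebra ℂ
    norm_smul_le := (Submodule.Quotient.normedSpace I ℂ).norm_smul_le }

end BanachQuotient

/-! ### Commutativity from the norm of powers -/

section LePage

open NormedSpace

variable {Q : Type*} [NormedRing Q] [NormedAlgebra ℂ Q] [CompleteSpace Q]

/-- If `‖z ^ n‖ = ‖z‖ ^ n` on a two-sided ideal, then `‖x y‖ ≤ ‖y x‖` there, hence the entire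
function `t ↦ exp (t a) b exp (-t a)` is bounded and, by Liouville's theorem, constant. -/
theorem commute_of_norm_pow_le {P : Set Q} (hl : ∀ z ∈ P, ∀ w, w * z ∈ P)
    (hr : ∀ z ∈ P, ∀ w, z * w ∈ P) (hP : ∀ z ∈ P, ∀ n : ℕ, ‖z‖ ^ (n + 1) ≤ ‖z ^ (n + 1)‖)
    (a : Q) {b : Q} (hb : b ∈ P) : a * b = b * a := by
  have hle : ∀ x y : Q, x * y ∈ P → ‖x * y‖ ≤ ‖y * x‖ := by
    intro x y hxy
    by_contra! hlt
    have hpow : ∀ n : ℕ, (x * y) ^ (n + 1) = x * (y * x) ^ n * y := fun n => by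
      induction n with
      | zero => simp
      | succ n ih => rw [pow_succ, ih, pow_succ]; noncomm_ring
    have hbd : ∀ n : ℕ, ‖x * y‖ ^ (n + 2) ≤ ‖x‖ * ‖y‖ * ‖y * x‖ ^ (n + 1) := fun n =>
      calc ‖x * y‖ ^ (n + 2) ≤ ‖x * (y * x) ^ (n + 1) * y‖ := by
            rw [← hpow]; exact hP _ hxy (n + 1)
        _ ≤ ‖x‖ * ‖y * x‖ ^ (n + 1) * ‖y‖ := by
            refine (norm_mul_le _ _).trans (mul_le_mul_of_nonneg_right ?_ (norm_nonneg _))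
            exact (norm_mul_le _ _).trans
              (mul_le_mul_of_nonneg_left (norm_pow_le' _ n.succ_pos) (norm_nonneg _))
        _ = _ := by ring
    have hpos : 0 < ‖x * y‖ := (norm_nonneg _).trans_lt hlt
    have hlim : Filter.Tendsto (fun n : ℕ => ‖x‖ * ‖y‖ * (‖y * x‖ / ‖x * y‖) ^ (n + 1))
        Filter.atTop (nhds (‖x‖ * ‖y‖ * 0)) :=
      ((tendsto_pow_atTop_nhds_zero_of_lt_one (by positivity)
        ((div_lt_one hpos).2 hlt)).comp (Filter.tendsto_add_atTop_nat 1)).const_mul _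
    rw [mul_zero] at hlim
    refine hpos.not_ge (ge_of_tendsto' hlim fun n => ?_)
    rw [div_pow, ← mul_div_assoc, le_div_iff₀ (by positivity), ← pow_succ']
    exact hbd n
  let _ : NormedAlgebra ℚ Q := .restrictScalars ℚ ℂ Q
  let F : ℂ → Q := fun t => exp (t • a) * b * exp (t • (-a))
  have hd : Differentiable ℂ F := by unfold F; fun_prop
  have hbounded : Bornology.IsBounded (Set.range F) := by
    refine (Metric.isBounded_closedBall (x := (0 : Q)) (r := ‖b‖)).subset ?_
    rintro _ ⟨t, rfl⟩
    rw [mem_closedBall_zero_iff]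
    refine (hle _ _ (hr _ (hl _ hb _) _)).trans_eq ?_
    rw [← mul_assoc, ← exp_add_of_commute (by simp)]
    simp
  have hF : ∀ t, F t = b := fun t => by
    rw [hd.apply_eq_apply_of_bounded hbounded t 0]; simp [F]
  have hexp : ∀ t : ℂ, exp (t • a) * b = b * exp (t • a) := fun t => by
    have h1 : exp (t • (-a)) * exp (t • a) = 1 := by
      rw [← exp_add_of_commute (by simp)]; simp
    conv_rhs => rw [← hF t]
    simp only [F]
    rw [mul_assoc (_ * b), h1, mul_one]
  have hder : HasDerivAt (fun t : ℂ => exp (t • a)) a 0 := by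
    simpa using hasDerivAt_exp_smul_const a (0 : ℂ)
  refine (hder.mul_const b).unique ?_
  simpa only [hexp] using hder.const_mul b

/-- In a commutative complex Banach algebra an element with `‖z ^ n‖ = ‖z‖ ^ n` that is not zero
is not annihilated by all characters. -/
theorem exists_algHom_apply_ne_zero (hcomm : ∀ a b : Q, a * b = b * a) {z : Q} (hz : z ≠ 0)
    (hpow : ∀ n : ℕ, ‖z‖ ^ (n + 1) ≤ ‖z ^ (n + 1)‖) : ∃ φ : Q →ₐ[ℂ] ℂ, φ z ≠ 0 := by
  have : Nontrivial Q := ⟨z, 0, hz⟩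
  have hspec : ‖z‖₊ ≤ spectralRadius ℂ z := by
    refine ge_of_tendsto (spectrum.pow_nnnorm_pow_one_div_tendsto_nhds_spectralRadius z)
      (Filter.eventually_atTop.2 ⟨1, fun n hn => ?_⟩)
    obtain ⟨n, rfl⟩ := Nat.exists_eq_add_of_le' hn
    have h1 : ‖z‖₊ ^ (n + 1) ≤ ‖z ^ (n + 1)‖₊ := hpow n
    have h2 : ((‖z‖₊ : ENNReal) ^ (n + 1)) ≤ ‖z ^ (n + 1)‖₊ := by exact_mod_cast h1
    calc (‖z‖₊ : ENNReal) = ((‖z‖₊ : ENNReal) ^ (n + 1)) ^ (1 / ((n + 1 : ℕ) : ℝ)) := by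
          rw [← ENNReal.rpow_natCast, ← ENNReal.rpow_mul, mul_one_div_cancel (by positivity),
            ENNReal.rpow_one]
      _ ≤ _ := ENNReal.rpow_le_rpow h2 (by positivity)
  obtain ⟨k, hk, hk'⟩ := spectrum.exists_nnnorm_eq_spectralRadius z
  let _ : NormedCommRing Q := { (inferInstance : NormedRing Q) with mul_comm := hcomm }
  obtain ⟨φ, hφ⟩ := WeakDual.CharacterSpace.mem_spectrum_iff_exists.1 hk
  refine ⟨WeakDual.CharacterSpace.equivAlgHom φ, ?_⟩
  rw [WeakDual.CharacterSpace.equivAlgHom_coe, hφ]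
  rintro rfl
  rw [← hk'] at hspec
  simp [hz] at hspec

end LePage

/-! ### The quotient norm of a C⋆-algebra -/

section CStarQuotient

open Ideal.Quotient (mk)

variable {U : Type*} [CStarAlgebra U] {I : Ideal U} [I.IsTwoSided] [IsClosed (I : Set U)]

theorem cfc_mul_self_eq {f : ℝ → ℝ} (hf : Continuous f) {a : U} (ha : IsSelfAdjoint a) :
    cfc f a * a = cfc (fun t => f t * t) a := by
  rw [cfc_mul f (fun t => t) a (by fun_prop) (by fun_prop), cfc_id' ℝ a]

theorem cfc_mul_self_mul_cfc_eq {f : ℝ → ℝ} (hf : Continuous f) {a : U} (ha : IsSelfAdjoint a) :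
    cfc f a * a * cfc f a = cfc (fun t => f t * t * f t) a := by
  rw [cfc_mul (fun t => f t * t) f a (by fun_prop) (by fun_prop), cfc_mul_self_eq hf ha]

theorem norm_quotient_mk_le (x : U) : ‖mk I x‖ ≤ ‖x‖ := Submodule.Quotient.norm_mk_le I x

/-- The nontrivial half of the C⋆-identity for the quotient norm. If `star x * x + i` nearly
attains the quotient norm, where `i = star i` lies in `I`, then `x v` with
`v = η² / (η² + i²)` nearly attains that of `x`, since `v i v` is small. -/
theorem norm_quotient_mk_sq_le (hI : ∀ i ∈ I, star i ∈ I) (x : U) :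
    ‖mk I x‖ ^ 2 ≤ ‖mk I (star x * x)‖ := by
  refine le_of_forall_pos_lt_add fun ε hε => ?_
  obtain ⟨m, hm, hmε⟩ := Submodule.Quotient.norm_mk_lt (mk I (star x * x)) (half_pos hε)
  have hm' : m - star x * x ∈ I := Ideal.Quotient.eq.1 hm
  set i : U := (2⁻¹ : ℂ) • ((m - star x * x) + star (m - star x * x)) with hi_def
  have hiI : i ∈ I := by
    rw [hi_def, Algebra.smul_def]
    exact I.mul_mem_left _ (I.add_mem hm' (hI _ hm'))
  have hi : IsSelfAdjoint i := by
    rw [isSelfAdjoint_iff, hi_def, star_smul, star_add, star_star, add_comm (star _)]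
    simp
  have hsum : star x * x + i = (2⁻¹ : ℂ) • (m + star m) := by
    rw [hi_def, star_sub, star_mul, star_star, eq_inv_smul_iff₀ two_ne_zero, smul_add,
      smul_inv_smul₀ two_ne_zero, two_smul]
    abel
  have hsum' : ‖star x * x + i‖ ≤ ‖m‖ := by
    rw [hsum, norm_smul]
    have := norm_add_le m (star m)
    rw [norm_star] at this
    norm_num
    linarith
  set η := ε / 2 with hη
  have hη0 : 0 < η := half_pos hε
  have hden : ∀ t : ℝ, η ^ 2 + t ^ 2 ≠ 0 := fun t => by positivity
  have hg : Continuous fun t : ℝ => η ^ 2 / (η ^ 2 + t ^ 2) := by fun_prop (disch := exact hden _)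
  have hk : Continuous fun t : ℝ => t / (η ^ 2 + t ^ 2) := by fun_prop (disch := exact hden _)
  set v : U := cfc (fun t : ℝ => η ^ 2 / (η ^ 2 + t ^ 2)) i with hv
  have hvs : star v = v := (cfc_predicate (fun t : ℝ => η ^ 2 / (η ^ 2 + t ^ 2)) i :
    IsSelfAdjoint v)
  have hv1 : ‖v‖ ≤ 1 := norm_cfc_le zero_le_one fun t _ => by
    rw [Real.norm_of_nonneg (by positivity), div_le_one (by positivity)]
    nlinarith [sq_nonneg t]
  have hvi : ‖v * i * v‖ ≤ η := by
    have h1 : v * i * v = cfc (fun t : ℝ => η ^ 2 / (η ^ 2 + t ^ 2) * t *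
        (η ^ 2 / (η ^ 2 + t ^ 2))) i := by
      rw [hv, cfc_mul_self_mul_cfc_eq hg hi]
    rw [h1]
    refine norm_cfc_le hη0.le fun t _ => ?_
    have h2 : η ^ 2 / (η ^ 2 + t ^ 2) * t * (η ^ 2 / (η ^ 2 + t ^ 2))
        = η * ((η * t) * η ^ 2) / (η ^ 2 + t ^ 2) ^ 2 := by
      have := hden t
      field_simp
    rw [h2, Real.norm_eq_abs, abs_div, abs_of_nonneg (sq_nonneg (η ^ 2 + t ^ 2)),
      div_le_iff₀ (by positivity), abs_mul, abs_of_pos hη0, abs_mul, abs_of_nonneg (sq_nonneg η)]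
    refine mul_le_mul_of_nonneg_left ?_ hη0.le
    rw [sq (η ^ 2 + t ^ 2)]
    refine mul_le_mul ?_ (by nlinarith [sq_nonneg t]) (by positivity) (by positivity)
    rw [abs_le]
    constructor <;> nlinarith [sq_nonneg (η - t), sq_nonneg (η + t)]
  have hvI : 1 - v ∈ I := by
    have h1 : 1 - v = cfc (fun t : ℝ => t / (η ^ 2 + t ^ 2)) i * i := by
      rw [cfc_mul_self_eq hk hi, hv, ← cfc_one ℝ i, ← cfc_sub _ _ i (by fun_prop) hg.continuousOn]
      refine cfc_congr fun t _ => ?_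
      have := hden t
      simp only [Pi.one_apply]
      field_simp
      ring
    rw [h1]
    exact I.mul_mem_left _ hiI
  have hxv : mk I x = mk I (x * v) := by
    rw [Ideal.Quotient.eq]
    have : x - x * v = x * (1 - v) := by noncomm_ring
    rw [this]
    exact I.mul_mem_left _ hvI
  calc ‖mk I x‖ ^ 2 ≤ ‖x * v‖ ^ 2 := by
        rw [hxv]; exact pow_le_pow_left₀ (norm_nonneg _) (norm_quotient_mk_le _) 2
    _ = ‖v * (star x * x + i) * v - v * i * v‖ := by
        rw [sq, ← CStarRing.norm_star_mul_self, star_mul, hvs]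
        congr 1
        noncomm_ring
    _ ≤ ‖v * (star x * x + i) * v‖ + ‖v * i * v‖ := norm_sub_le _ _
    _ ≤ ‖m‖ + η := by
        refine add_le_add ?_ hvi
        calc _ ≤ ‖v * (star x * x + i)‖ * ‖v‖ := norm_mul_le _ _
          _ ≤ ‖v * (star x * x + i)‖ := mul_le_of_le_one_right (norm_nonneg _) hv1
          _ ≤ ‖v‖ * ‖star x * x + i‖ := norm_mul_le _ _
          _ ≤ _ := (mul_le_of_le_one_left (norm_nonneg _) hv1).trans hsum'
    _ < _ := by linarith

/-- An element `x` of `U` lies in the closed ideal `I` as soon as `star x * x` does. -/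
theorem mem_of_star_mul_self_mem (hI : ∀ i ∈ I, star i ∈ I) {x : U} (hx : star x * x ∈ I) :
    x ∈ I := by
  have h := norm_quotient_mk_sq_le hI x
  rw [Ideal.Quotient.eq_zero_iff_mem.2 hx, norm_zero] at h
  rw [← Ideal.Quotient.eq_zero_iff_mem, ← norm_eq_zero]
  exact pow_eq_zero_iff two_ne_zero |>.1 (h.antisymm (by positivity))

variable {P : Ideal U}

/-- Let `g` be a function of `star x * x` that is `1` on the support of `h` and vanishes below
`α`. Then `(1 - g) w h` is square zero, so it vanishes in the quotient, and `g = (k x⋆) x`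
with `‖k x⋆‖ ≤ 1 / √α`. -/
theorem sqrt_mul_norm_le_norm_mul (hP : ∀ z ∈ P, z * z = 0 → z ∈ I) {α β : ℝ} (hα : 0 < α)
    (hαβ : α < β) (x : U) {w : U}
    (hw : w * cfc (fun t : ℝ => max 0 (t - β)) (star x * x) ∈ P) :
    √α * ‖mk I (w * cfc (fun t : ℝ => max 0 (t - β)) (star x * x))‖
      ≤ ‖mk I (x * (w * cfc (fun t : ℝ => max 0 (t - β)) (star x * x)))‖ := by
  set c := star x * x with hc
  have hcs : IsSelfAdjoint c := .star_mul_self x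
  set h := cfc (fun t : ℝ => max 0 (t - β)) c
  set g := cfc (ramp α β) c with hg
  set k := cfc (fun t : ℝ => ramp α β t / max t α) c with hk
  have hkc : Continuous fun t : ℝ => ramp α β t / max t α := continuous_ramp_div_max hα
  have hks : star k = k := (cfc_predicate (fun t : ℝ => ramp α β t / max t α) c : IsSelfAdjoint k)
  have hhg : h * g = h := by
    rw [hg, ← cfc_mul _ _ c (by fun_prop) (by fun_prop)]
    refine cfc_congr fun t _ => ?_
    rcases le_total t β with ht | ht
    · simp only [max_eq_left (sub_nonpos.2 ht), zero_mul]
    · simp only [ramp_eq_one hαβ ht, mul_one]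
  have hgk : g = k * c := by
    rw [hk, cfc_mul_self_eq hkc hcs]
    simp only [ramp_div_max_mul hα hαβ]
    rfl
  have hz : w * h - g * (w * h) ∈ I := by
    refine hP _ (P.sub_mem hw (P.mul_mem_left _ hw)) ?_
    have h0 : h * (w * h - g * (w * h)) = h * w * h - h * g * (w * h) := by noncomm_ring
    have h1 : h * (w * h - g * (w * h)) = 0 := by rw [h0, hhg]; noncomm_ring
    calc (w * h - g * (w * h)) * (w * h - g * (w * h))
        = (w - g * w) * (h * (w * h - g * (w * h))) := by noncomm_ring
      _ = 0 := by rw [h1, mul_zero]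
  have hkx : ‖k * star x‖ ≤ 1 / √α := by
    rw [one_div, ← Real.sqrt_inv]
    refine Real.le_sqrt_of_sq_le ?_
    have h1 : k * star x * star (k * star x) = cfc (fun t : ℝ => ramp α β t / max t α * t *
        (ramp α β t / max t α)) c := by
      rw [← cfc_mul_self_mul_cfc_eq hkc hcs, star_mul, star_star, hks, ← hk, hc]
      noncomm_ring
    rw [sq, ← CStarRing.norm_self_mul_star, h1]
    refine norm_cfc_le (by positivity) fun t _ => ?_
    have hm : 0 < max t α := lt_max_of_lt_right hα
    rw [ramp_div_max_mul hα hαβ, Real.norm_of_nonneg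
      (mul_nonneg ramp_nonneg (div_nonneg ramp_nonneg hm.le)), ← one_div]
    calc _ ≤ 1 * (1 / α) := by
          refine mul_le_mul ramp_le_one ?_ (div_nonneg ramp_nonneg hm.le) zero_le_one
          exact div_le_div₀ zero_le_one ramp_le_one hα (le_max_right _ _)
      _ = _ := one_mul _
  have hmk : mk I (w * h) = mk I (k * star x) * mk I (x * (w * h)) := by
    rw [Ideal.Quotient.eq.2 hz, hgk, hc, ← map_mul]
    congr 1
    noncomm_ring
  have hα' : 0 < √α := Real.sqrt_pos.2 hα
  calc √α * ‖mk I (w * h)‖ ≤ √α * (1 / √α * ‖mk I (x * (w * h))‖) := by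
        refine mul_le_mul_of_nonneg_left ?_ hα'.le
        rw [hmk]
        refine (norm_mul_le _ _).trans (mul_le_mul_of_nonneg_right ?_ (norm_nonneg _))
        exact (norm_quotient_mk_le _).trans hkx
    _ = _ := by field_simp

section Ordered

variable [PartialOrder U] [StarOrderedRing U]

/-- If the square zero elements of `P` lie in `I`, then the norm of `P / I` is multiplicative on
powers. -/
theorem norm_quotient_mk_pow_le (hI : ∀ i ∈ I, star i ∈ I) (hP : ∀ z ∈ P, z * z = 0 → z ∈ I)
    {x : U} (hx : x ∈ P) (n : ℕ) : ‖mk I x‖ ^ (n + 1) ≤ ‖mk I x ^ (n + 1)‖ := by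
  set c := star x * x with hc
  have hcs : IsSelfAdjoint c := .star_mul_self x
  have hcP : c ∈ P := P.mul_mem_left _ hx
  rcases (norm_nonneg (mk I x)).eq_or_lt with h0 | h0
  · rw [← h0]; simp
  suffices key : ∀ s : ℝ, 0 < s → s < ‖mk I x‖ → s ^ (n + 1) ≤ ‖mk I x ^ (n + 1)‖ by
    have hlim : Filter.Tendsto (fun s : ℝ => s ^ (n + 1)) (nhdsWithin ‖mk I x‖ (Set.Iio ‖mk I x‖))
        (nhds (‖mk I x‖ ^ (n + 1))) :=
      ((continuous_pow (n + 1)).tendsto _).mono_left nhdsWithin_le_nhds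
    refine le_of_tendsto hlim ?_
    filter_upwards [self_mem_nhdsWithin, mem_nhdsWithin_of_mem_nhds (lt_mem_nhds h0)] with s h1 h2
    exact key s h2 h1
  intro s hs hsx
  have hα : 0 < s ^ 2 := by positivity
  have hlt : s ^ 2 < ‖mk I x‖ ^ 2 := pow_lt_pow_left₀ hsx hs.le two_ne_zero
  obtain ⟨β, hβ1, hβ2⟩ := exists_between hlt
  have hβ0 : 0 < β := hα.trans hβ1
  set h := cfc (fun t : ℝ => max 0 (t - β)) c with hh
  have hhP : h ∈ P := by
    have hcont : Continuous fun t : ℝ => max 0 (t - β) / max t β :=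
      Continuous.div (by fun_prop) (by fun_prop) fun _ => (lt_max_of_lt_right hβ0).ne'
    have : h = cfc (fun t : ℝ => max 0 (t - β) / max t β) c * c := by
      rw [cfc_mul_self_eq hcont hcs]
      refine cfc_congr fun t _ => ?_
      rcases le_total t β with ht | ht
      · simp [max_eq_left (sub_nonpos.2 ht)]
      · simp only [max_eq_left ht]
        rw [div_mul_cancel₀ _ (by linarith)]
    rw [this]
    exact P.mul_mem_left _ hcP
  have hh0 : 0 < ‖mk I h‖ := by
    have h1 : ‖c - h‖ ≤ β := by
      have : c - h = cfc (fun t : ℝ => t - max 0 (t - β)) c := by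
        rw [cfc_sub _ _ c (by fun_prop) (by fun_prop), cfc_id' ℝ c]
      rw [this]
      refine norm_cfc_le hβ0.le fun t ht => ?_
      have ht0 : 0 ≤ t := spectrum_nonneg_of_nonneg (star_mul_self_nonneg x) ht
      rw [Real.norm_eq_abs, abs_le]
      rcases le_total t β with hb | hb
      · rw [max_eq_left (sub_nonpos.2 hb)]; constructor <;> linarith
      · rw [max_eq_right (sub_nonneg.2 hb)]; constructor <;> linarith
    have h2 : ‖mk I c‖ ≤ ‖c - h‖ + ‖mk I h‖ := by
      have : mk I c = mk I (c - h) + mk I h := by rw [← map_add, sub_add_cancel]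
      rw [this]
      exact (norm_add_le _ _).trans (add_le_add_left (norm_quotient_mk_le _) _)
    have h3 := norm_quotient_mk_sq_le hI x
    rw [← hc] at h3
    linarith
  have hpow : ∀ m : ℕ, s ^ m * ‖mk I h‖ ≤ ‖mk I (x ^ m * h)‖ := fun m => by
    induction m with
    | zero => simp
    | succ m ih =>
      have h1 := sqrt_mul_norm_le_norm_mul (I := I) hP hα hβ1 x (w := x ^ m)
        (P.mul_mem_left _ hhP)
      rw [← hc, ← hh, Real.sqrt_sq hs.le, ← mul_assoc x, ← pow_succ'] at h1
      refine le_trans ?_ h1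
      rw [pow_succ', mul_assoc]
      exact mul_le_mul_of_nonneg_left ih hs.le
  have h1 := hpow (n + 1)
  rw [map_mul, map_pow] at h1
  exact le_of_mul_le_mul_right (h1.trans (norm_mul_le _ _)) hh0

end Ordered

/-- If the square zero elements of the ideal `P` of codimension at most one lie in the closed
ideal `I`, then either `P ≤ I` or some character of `U` does not vanish on `P`. -/
theorem exists_algHom_ne_zero [P.IsTwoSided] (hI : ∀ i ∈ I, star i ∈ I)
    (hP : ∀ z ∈ P, z * z = 0 → z ∈ I) (hU : ∀ u : U, ∃ k : ℂ, u - algebraMap ℂ U k ∈ P)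
    (hPI : ¬ P ≤ I) :
    ∃ φ : U →ₐ[ℂ] ℂ, ∃ p ∈ P, φ p ≠ 0 := by
  let _ := CStarAlgebra.spectralOrder U
  have _ := CStarAlgebra.spectralOrderedRing U
  have hpow : ∀ x ∈ P, ∀ n : ℕ, ‖mk I x‖ ^ (n + 1) ≤ ‖mk I x ^ (n + 1)‖ := fun x hx n =>
    norm_quotient_mk_pow_le hI hP hx n
  have hcomp : CompleteSpace (U ⧸ I) := Submodule.Quotient.completeSpace I
  have hcomm : ∀ a b : U ⧸ I, a * b = b * a := by
    have h1 : ∀ a, ∀ x ∈ P, a * mk I x = mk I x * a := fun a x hx => by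
      refine commute_of_norm_pow_le (P := mk I '' (P : Set U)) ?_ ?_ ?_ a ⟨x, hx, rfl⟩
      · rintro _ ⟨y, hy, rfl⟩ w
        obtain ⟨w, rfl⟩ := Ideal.Quotient.mk_surjective w
        exact ⟨w * y, P.mul_mem_left _ hy, map_mul _ _ _⟩
      · rintro _ ⟨y, hy, rfl⟩ w
        obtain ⟨w, rfl⟩ := Ideal.Quotient.mk_surjective w
        exact ⟨y * w, P.mul_mem_right _ hy, map_mul _ _ _⟩
      · rintro _ ⟨y, hy, rfl⟩ n
        exact hpow y hy n
    intro a b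
    obtain ⟨b, rfl⟩ := Ideal.Quotient.mk_surjective b
    obtain ⟨k, hk⟩ := hU b
    have h2 : mk I b = mk I (b - algebraMap ℂ U k) + algebraMap ℂ (U ⧸ I) k := by
      rw [map_sub, Ideal.Quotient.mk_algebraMap, sub_add_cancel]
    rw [h2, mul_add, add_mul, h1 a _ hk, Algebra.commutes]
  obtain ⟨p, hp, hpI⟩ := Set.not_subset.1 hPI
  obtain ⟨φ, hφ⟩ := exists_algHom_apply_ne_zero hcomm
    (mt Ideal.Quotient.eq_zero_iff_mem.1 hpI) (hpow p hp)
  exact ⟨φ.comp (Ideal.Quotient.mkₐ ℂ I), p, hp, hφ⟩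

end CStarQuotient

/-! ### Square zero elements are commutators -/

section SquareZero

variable {A : Type*} [NonUnitalCStarAlgebra A] [PartialOrder A] [StarOrderedRing A]

/-- With `s = |z| ^ (1/2)` one has `z = y s` and `s y = 0`, where `y` is the norm limit of
`z s (s² + η²)⁻¹` as `η → 0`. -/
theorem exists_eq_commutator_of_mem_N₂ {z : A} (hz : z ∈ N₂ A) :
    ∃ y s : A, z = y * s - s * y := by
  set c := star z * z with hc_def
  have hc : IsSelfAdjoint c := .star_mul_self z
  have hcz : c * z = 0 := by
    have : z * z = 0 := hz
    rw [hc_def, mul_assoc, this, mul_zero]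
  have hc0 : ∀ t ∈ quasispectrum ℝ c, 0 ≤ t :=
    quasispectrum_nonneg_of_nonneg c (star_mul_self_nonneg z)
  set s := cfcₙ (fun t : ℝ => √√t) c with hs
  have hss : star s = s := (cfcₙ_predicate (fun t : ℝ => √√t) c : IsSelfAdjoint s)
  have hs4 : s * s * (s * s) = c := by
    have h1 : s * s = cfcₙ (fun t : ℝ => √t) c := by
      rw [hs, ← cfcₙ_mul _ _ c (by fun_prop) (by simp) (by fun_prop) (by simp)]
      simp only [Real.mul_self_sqrt (Real.sqrt_nonneg _)]
    rw [h1, ← cfcₙ_mul _ _ c (by fun_prop) (by simp) (by fun_prop) (by simp)]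
    conv_rhs => rw [← cfcₙ_id' ℝ c hc]
    exact cfcₙ_congr fun t ht => Real.mul_self_sqrt (hc0 t ht)
  have hsz : s * z = 0 := by
    have h1 : s * s * z = 0 := by
      rw [← CStarRing.star_mul_self_eq_zero_iff, star_mul, star_mul, hss]
      have : star z * (s * s) * (s * s * z) = star z * (s * s * (s * s) * z) := by noncomm_ring
      rw [this, hs4, hcz, mul_zero]
    rw [← CStarRing.star_mul_self_eq_zero_iff, star_mul, hss]
    have : star z * s * (s * z) = star z * (s * s * z) := by noncomm_ring
    rw [this, h1, mul_zero]
  -- `η n = 2 ^ (-n)`, in the form used by `cauchySeq_of_le_geometric_two`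
  let η : ℕ → ℝ := fun n => 2 / 2 / 2 ^ n
  have hη : ∀ n, 0 < η n := fun n => by positivity
  let H : ℕ → ℝ → ℝ := fun n t => √√t / (√t + η n ^ 2)
  have hden : ∀ n t, √t + η n ^ 2 ≠ 0 := fun n t => by
    have := hη n
    positivity
  have hH : ∀ n, Continuous (H n) := fun n =>
    Continuous.div (by fun_prop) (by fun_prop) (hden n)
  have hH0 : ∀ n, H n 0 = 0 := fun n => by simp [H]
  -- `√t * H n t = r - r η² / (r² + η²)` with `r = t ^ (1/4)`
  have hHt : ∀ n t, √t * H n t ≤ √√t ∧ √√t - η n ≤ √t * H n t := fun n t => by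
    have h1 : √t = √√t ^ 2 := (Real.sq_sqrt (Real.sqrt_nonneg t)).symm
    have h2 := Real.sqrt_nonneg (√t)
    have h3 := hη n
    simp only [H]
    set r := √√t
    rw [h1, ← mul_div_assoc, div_le_iff₀ (by positivity), le_div_iff₀ (by positivity)]
    constructor
    · nlinarith [mul_nonneg h2 (sq_nonneg (η n))]
    · nlinarith [mul_nonneg h3.le (sq_nonneg (r - η n)), mul_nonneg (mul_nonneg h2 h3.le) h3.le,
        mul_nonneg h3.le (sq_nonneg r), pow_pos h3 3]
  let y : ℕ → A := fun n => z * cfcₙ (H n) c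
  have hη1 : ∀ n, η (n + 1) ≤ η n := fun n => by
    simp only [η]
    exact div_le_div_of_nonneg_left (by norm_num) (by positivity)
      (pow_le_pow_right₀ one_le_two n.le_succ)
  have hcauchy : CauchySeq y := by
    refine cauchySeq_of_le_geometric_two (C := 2) fun n => ?_
    have h1 := norm_smul_sub_mul_cfcₙ_le (k := 0) ((hH n).sub (hH (n + 1)))
      (by simp [hH0]) z (hη n).le fun t _ => ?_
    · have h2 : (0 : ℝ) • z - z * cfcₙ (H n - H (n + 1)) c = -(y n - y (n + 1)) := by
        have : cfcₙ (H n - H (n + 1)) c = cfcₙ (H n) c - cfcₙ (H (n + 1)) c :=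
          cfcₙ_sub _ _ c (hH n).continuousOn (hH0 n) (hH (n + 1)).continuousOn (hH0 (n + 1))
        rw [zero_smul, zero_sub, this, mul_sub]
      rw [dist_eq_norm, ← norm_neg, ← h2]
      exact h1
    · rw [zero_sub, abs_neg, ← abs_of_nonneg (Real.sqrt_nonneg t), ← abs_mul, abs_le]
      have h3 := hHt n t
      have h4 := hHt (n + 1) t
      have h5 := hη1 n
      simp only [Pi.sub_apply, mul_sub]
      constructor <;> linarith
  obtain ⟨w, hw⟩ := cauchySeq_tendsto_of_complete hcauchy
  refine ⟨w, s, ?_⟩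
  have hsw : s * w = 0 := by
    refine tendsto_nhds_unique (hw.const_mul s) ?_
    simp only [y, ← mul_assoc, hsz, zero_mul]
    exact tendsto_const_nhds
  have hη0 : Filter.Tendsto (fun n => η n) Filter.atTop (nhds 0) := by
    have := (tendsto_pow_atTop_nhds_zero_of_lt_one (r := (1 / 2 : ℝ)) (by norm_num)
      (by norm_num)).const_mul (2 / 2 : ℝ)
    rw [mul_zero] at this
    refine this.congr fun n => ?_
    simp [η]
  have hws : z = w * s := by
    have h1 : Filter.Tendsto (fun n => ‖z - y n * s‖) Filter.atTop (nhds 0) := by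
      have hsq : Filter.Tendsto (fun n => η n ^ 2) Filter.atTop (nhds 0) := by
        simpa using hη0.pow 2
      refine squeeze_zero (fun n => norm_nonneg _) (fun n => ?_) hsq
      have h2 := norm_smul_sub_mul_cfcₙ_le (k := 1) (g := fun t => H n t * √√t)
        ((hH n).mul (by fun_prop)) (by simp) z (sq_nonneg (η n)) fun t _ => ?_
      · rw [one_smul, cfcₙ_mul _ _ _ (hH n).continuousOn (hH0 n) (by fun_prop) (by simp),
          ← mul_assoc] at h2
        exact h2
      · have h3 : 1 - H n t * √√t = η n ^ 2 / (√t + η n ^ 2) := by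
          have h4 := hden n t
          simp only [H]
          rw [div_mul_eq_mul_div, Real.mul_self_sqrt (Real.sqrt_nonneg t)]
          field_simp
          ring
        rw [h3, abs_of_nonneg (by positivity), ← mul_div_assoc, div_le_iff₀
          (lt_of_le_of_ne (by positivity) (hden n t).symm)]
        nlinarith [Real.sqrt_nonneg t, sq_nonneg (η n), sq_nonneg (η n ^ 2)]
    have h2 := (tendsto_const_nhds (x := z)).sub (hw.mul_const s) |>.norm
    exact sub_eq_zero.1 (norm_eq_zero.1 (tendsto_nhds_unique h2 h1))
  rw [hsw, sub_zero]
  exact hws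

end SquareZero

/-! ### The Pedersen ideal -/

section Pedersen

variable {A : Type*} [NonUnitalCStarAlgebra A]

/-- An ideal subspace of `A` as a two-sided ideal of the unitization. -/
def IsIdealSubspace.toIdeal {K : Submodule ℂ A} (hK : IsIdealSubspace K) :
    Ideal (Unitization ℂ A) where
  carrier := (fun a : A => (a : Unitization ℂ A)) '' K
  add_mem' := by
    rintro _ _ ⟨a, ha, rfl⟩ ⟨b, hb, rfl⟩
    exact ⟨a + b, K.add_mem ha hb, Unitization.inr_add ℂ a b⟩
  zero_mem' := ⟨0, K.zero_mem, Unitization.inr_zero ℂ⟩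
  smul_mem' := by
    rintro u _ ⟨a, ha, rfl⟩
    refine ⟨u.fst • a + u.snd * a, K.add_mem (K.smul_mem _ ha) (hK _ _ ha).1, ?_⟩
    ext <;> simp

theorem IsIdealSubspace.coe_mem_toIdeal {K : Submodule ℂ A} (hK : IsIdealSubspace K) {a : A} :
    (a : Unitization ℂ A) ∈ hK.toIdeal ↔ a ∈ K :=
  ⟨fun ⟨_, hb, h⟩ => Unitization.inr_injective h ▸ hb, fun h => ⟨a, h, rfl⟩⟩

instance IsIdealSubspace.isTwoSided_toIdeal {K : Submodule ℂ A} (hK : IsIdealSubspace K) :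
    hK.toIdeal.IsTwoSided where
  mul_mem_of_left := by
    rintro _ u ⟨a, ha, rfl⟩
    refine ⟨u.fst • a + a * u.snd, K.add_mem (K.smul_mem _ ha) (hK _ _ ha).2, ?_⟩
    ext <;> simp

theorem IsIdealSubspace.isClosed_toIdeal {K : Submodule ℂ A} (hK : IsIdealSubspace K)
    (hc : IsClosed (K : Set A)) : IsClosed (hK.toIdeal : Set (Unitization ℂ A)) :=
  (Unitization.isometry_inr (𝕜 := ℂ) (A := A)).isClosedEmbedding.isClosedMap _ hc

theorem IsIdealSubspace.topologicalClosure {K : Submodule ℂ A} (hK : IsIdealSubspace K) :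
    IsIdealSubspace K.topologicalClosure := by
  intro a x hx
  constructor
  · exact map_mem_closure (f := fun y => a * y) (by fun_prop) hx fun y hy => (hK a y hy).1
  · exact map_mem_closure (f := fun y => y * a) (by fun_prop) hx fun y hy => (hK a y hy).2

theorem isIdealSubspace_top : IsIdealSubspace (⊤ : Submodule ℂ A) := fun _ _ _ => ⟨trivial, trivial⟩

theorem isIdealSubspace_pedersenIdeal : IsIdealSubspace (pedersenIdeal A) := by
  intro a x hx
  simp only [pedersenIdeal, Submodule.mem_sInf] at hx ⊢
  exact ⟨fun I hI => (hI.1 a x (hx I hI)).1, fun I hI => (hI.1 a x (hx I hI)).2⟩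

/-- An element with a local left unit `e` lies in every dense ideal: for `j` in the ideal close
to `e` one has `a = (1 - (e - j))⁻¹ j a`. -/
theorem mem_pedersenIdeal_of_mul_eq {e a : A} (h : e * a = a) : a ∈ pedersenIdeal A := by
  simp only [pedersenIdeal, Submodule.mem_sInf]
  rintro K ⟨hK, hd⟩
  obtain ⟨j, hj, hej⟩ := Metric.dense_iff.1 hd e 1 one_pos
  have hlt : ‖((e - j : A) : Unitization ℂ A)‖ < 1 := by
    rw [Unitization.norm_inr, ← dist_eq_norm, dist_comm]
    exact hj
  obtain ⟨u, hu⟩ := isUnit_one_sub_of_norm_lt_one hlt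
  have h1 : (u : Unitization ℂ A) * a = ((j * a : A) : Unitization ℂ A) := by
    rw [hu, sub_mul, one_mul, ← Unitization.inr_mul, sub_mul, h, ← Unitization.inr_sub,
      sub_sub_cancel]
  rw [← hK.coe_mem_toIdeal, ← u.inv_mul_cancel_left (a : Unitization ℂ A), h1]
  exact Ideal.mul_mem_left _ _ (hK.coe_mem_toIdeal.2 (hK a j hej).2)

theorem conj_mem {K : Submodule ℂ A} (hK : IsIdealSubspace K) {a : A} (ha : a ∈ K) (x : A) :
    conj x a ∈ K :=
  K.sub_mem (K.sub_mem (K.add_mem ha (hK x a ha).1) (hK x a ha).2)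
    (hK x _ (hK x a ha).1).2

/-- If `x e = x`, then `x g(e) = g(1) x` for functions `g`; here `g` is a ramp that equals `1`
near `1`. -/
theorem mul_cfcₙ_ramp_eq {x e : A} (he : IsSelfAdjoint e) (h : x * e = x) {α β : ℝ} (hα : 0 ≤ α)
    (hαβ : α < β) (hβ : β < 1) : x * cfcₙ (ramp α β) e = x := by
  -- `ramp α β t = t + (1 - t) * k t`
  let k : ℝ → ℝ := fun t => 1 - (1 - ramp α β t) / max (1 - t) (1 - β)
  have hm : ∀ t : ℝ, 0 < max (1 - t) (1 - β) := fun t => lt_max_of_lt_right (by linarith)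
  have hk : Continuous k :=
    continuous_const.sub (Continuous.div (by fun_prop) (by fun_prop) fun t => (hm t).ne')
  have hk0 : k 0 = 0 := by
    simp only [k, ramp_zero hα hαβ, sub_zero]
    rw [max_eq_left (by linarith)]; norm_num
  have hkt : ∀ t, t + (k t - t * k t) = ramp α β t := fun t => by
    simp only [k]
    rcases le_total t β with ht | ht
    · rw [max_eq_left (by linarith)]
      have : 1 - t ≠ 0 := by linarith
      field_simp
      ring
    · rw [ramp_eq_one hαβ ht]; simp
  have h1 : cfcₙ (ramp α β) e = e + (cfcₙ k e - e * cfcₙ k e) := by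
    have hid : cfcₙ (fun t : ℝ => t) e = e := cfcₙ_id' ℝ e he
    have h2 : cfcₙ (fun t => t + (k t - t * k t)) e = e + (cfcₙ k e - e * cfcₙ k e) := by
      rw [cfcₙ_add _ _ e (by fun_prop) rfl (by fun_prop) (by simp [hk0]),
        cfcₙ_sub _ _ e (by fun_prop) hk0 (by fun_prop) (by simp),
        cfcₙ_mul _ _ e (by fun_prop) rfl (by fun_prop) hk0, hid]
    rw [← h2]
    simp only [hkt]
  rw [h1, mul_add, mul_sub, ← mul_assoc, h, sub_self, add_zero]

variable [PartialOrder A] [StarOrderedRing A]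

theorem span_SN₂c_le :
    Submodule.span ℂ (SN₂c A) ≤ commSpan (pedersenIdeal A : Set A) (pedersenIdeal A : Set A) := by
  rw [Submodule.span_le]
  rintro _ ⟨y, hy, x, ⟨e, f, he, hf, hxe, hfx, hef⟩, rfl⟩
  have hes := he.isSelfAdjoint
  have h2 : (0 : ℝ) < 1 / 2 := by norm_num
  have hx : x ∈ pedersenIdeal A := mem_pedersenIdeal_of_mul_eq hfx
  have hr : rung (1 / 2) e 0 ∈ pedersenIdeal A :=
    mem_pedersenIdeal_of_mul_eq (rung_mul_rung h2 e zero_lt_one).2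
  have h1 : x * rung (1 / 2) e 0 = x :=
    mul_cfcₙ_ramp_eq hes hxe (by norm_num) (rung_lt h2 0) (by norm_num)
  have h0 : rung (1 / 2) e 0 * x = 0 := by
    rw [rung, (cfcₙ_ramp_eq_mul (by norm_num) (rung_lt h2 0) e hes).1, ← hfx, mul_assoc,
      ← mul_assoc e, hef, zero_mul, mul_zero]
  refine Submodule.subset_span ⟨conj y x, conj_mem isIdealSubspace_pedersenIdeal hx y,
    conj y (rung (1 / 2) e 0), conj_mem isIdealSubspace_pedersenIdeal hr y, ?_⟩
  rw [← conj_mul hy, ← conj_mul hy, ← conj_sub, h1, h0, sub_zero]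

end Pedersen

/-! ### The ideal generated by cut down square zero elements -/

section DenseIdeal

variable (A : Type*) [NonUnitalCStarAlgebra A]

/-- The two-sided ideal spanned by the elements `a x x⋆ b`, where `x` runs through the cut down
square zero elements. -/
noncomputable def cutIdeal : Submodule ℂ A :=
  Submodule.span ℂ {w : A | ∃ z ∈ N₂ A, ∃ δ : ℝ, 0 < δ ∧ ∃ a b : A,
    w = a * (cut δ z * star (cut δ z)) * b}

variable {A}

theorem isIdealSubspace_cutIdeal : IsIdealSubspace (cutIdeal A) := by
  intro c w hw
  induction hw using Submodule.span_induction with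
  | mem w hw =>
    obtain ⟨z, hz, δ, hδ, a, b, rfl⟩ := hw
    exact ⟨Submodule.subset_span ⟨z, hz, δ, hδ, c * a, b, by simp only [mul_assoc]⟩,
      Submodule.subset_span ⟨z, hz, δ, hδ, a, b * c, by simp only [mul_assoc]⟩⟩
  | zero => simp
  | add v w _ _ hv hw =>
    rw [mul_add, add_mul]
    exact ⟨Submodule.add_mem _ hv.1 hw.1, Submodule.add_mem _ hv.2 hw.2⟩
  | smul k w _ hw =>
    rw [mul_smul_comm, smul_mul_assoc]
    exact ⟨Submodule.smul_mem _ k hw.1, Submodule.smul_mem _ k hw.2⟩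

theorem star_mem_cutIdeal {w : A} (hw : w ∈ cutIdeal A) : star w ∈ cutIdeal A := by
  induction hw using Submodule.span_induction with
  | mem w hw =>
    obtain ⟨z, hz, δ, hδ, a, b, rfl⟩ := hw
    exact Submodule.subset_span ⟨z, hz, δ, hδ, star b, star a, by simp only [star_mul, star_star,
      mul_assoc]⟩
  | zero => simp
  | add v w _ _ hv hw => rw [star_add]; exact Submodule.add_mem _ hv hw
  | smul k w _ hw => rw [star_smul]; exact Submodule.smul_mem _ _ hw

variable [PartialOrder A] [StarOrderedRing A]

theorem sumOf_commutator_sandwich {δ : ℝ} (hδ : 0 < δ) {z : A} (hz : z ∈ N₂ A) (a b y : A) :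
    SumOf (SN₂c A) 152 (a * (cut δ z * star (cut δ z)) * b * y
      - y * (a * (cut δ z * star (cut δ z)) * b)) := by
  have key := (sumOf_commutator_cut hδ hz b (y * a)).sub smul_mem_SN₂c
    (sumOf_commutator_cut hδ hz (b * y) a)
  convert key using 1
  noncomm_ring

/-- A fixed element `w` of `cutIdeal A` is a finite sum of generators, so the number of summands
needed for `[w x, y]` does not depend on `x` and `y`. -/
theorem exists_sumOf_commutator_mul {w : A} (hw : w ∈ cutIdeal A) :
    ∃ n, ∀ x y : A, SumOf (SN₂c A) n (w * x * y - y * (w * x)) := by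
  induction hw using Submodule.span_induction with
  | mem w hw =>
    obtain ⟨z, hz, δ, hδ, a, b, rfl⟩ := hw
    refine ⟨152, fun x y => ?_⟩
    have := sumOf_commutator_sandwich hδ hz a (b * x) y
    rwa [← mul_assoc _ b x] at this
  | zero => exact ⟨0, fun x y => by simpa using SumOf.zero⟩
  | add v w _ _ hv hw =>
    obtain ⟨m, hm⟩ := hv
    obtain ⟨n, hn⟩ := hw
    refine ⟨m + n, fun x y => ?_⟩
    convert (hm x y).add (hn x y) using 1
    noncomm_ring
  | smul k w _ hw =>
    obtain ⟨n, hn⟩ := hw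
    refine ⟨n, fun x y => ?_⟩
    convert (hn x y).smul smul_mem_SN₂c k using 1
    simp only [smul_mul_assoc, mul_smul_comm, smul_sub]

theorem commutator_mem_span_SN₂c {w : A} (hw : w ∈ cutIdeal A) (y : A) :
    w * y - y * w ∈ Submodule.span ℂ (SN₂c A) := by
  induction hw using Submodule.span_induction with
  | mem w hw =>
    obtain ⟨z, hz, δ, hδ, a, b, rfl⟩ := hw
    exact (sumOf_commutator_sandwich hδ hz a b y).mem_span
  | zero => simp
  | add v w _ _ hv hw =>
    convert Submodule.add_mem _ hv hw using 1
    noncomm_ring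
  | smul k w _ hw =>
    convert Submodule.smul_mem _ k hw using 1
    simp only [smul_mul_assoc, mul_smul_comm, smul_sub]

/-- The closure `I` of `cutIdeal A` contains all square zero elements. Unless `I = A` there is
then a character of the unitization that does not vanish on `A`, that is, a nonzero
`*`-homomorphism from `A` to `ℂ`. -/
theorem dense_cutIdeal (hA : NoOneDimRep A) : Dense (cutIdeal A : Set A) := by
  set K := (cutIdeal A).topologicalClosure
  have hK : IsIdealSubspace K := isIdealSubspace_cutIdeal.topologicalClosure
  have _ : IsClosed (hK.toIdeal : Set (Unitization ℂ A)) :=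
    hK.isClosed_toIdeal (Submodule.isClosed_topologicalClosure _)
  have hI : ∀ i ∈ hK.toIdeal, star i ∈ hK.toIdeal := by
    rintro _ ⟨a, ha, rfl⟩
    exact ⟨star a, map_mem_closure continuous_star ha fun w hw => star_mem_cutIdeal hw,
      Unitization.inr_star a⟩
  have hstar : ∀ a : A, star a * a ∈ K → a ∈ K := fun a ha => by
    rw [← hK.coe_mem_toIdeal] at ha ⊢
    refine mem_of_star_mul_self_mem hI ?_
    rwa [← Unitization.inr_star, ← Unitization.inr_mul]
  have hcut : ∀ z ∈ N₂ A, ∀ δ : ℝ, 0 < δ → cut δ z ∈ K := by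
    intro z hz δ hδ
    set t := cut δ z * star (cut δ z) with ht
    have hts : star t = t := by rw [ht, star_mul, star_star]
    have h4 : star (t * t) * (t * t) ∈ K := by
      refine Submodule.le_topologicalClosure _ (Submodule.subset_span
        ⟨z, hz, δ, hδ, t, t * t, ?_⟩)
      simp only [star_mul, hts, ← ht, mul_assoc]
    have h2 : star t * t ∈ K := by rw [hts]; exact hstar _ h4
    have h1 : star (star (cut δ z)) * star (cut δ z) ∈ K := by rw [star_star]; exact hstar _ h2
    have h0 := hI _ (hK.coe_mem_toIdeal.2 (hstar _ h1))
    rwa [← Unitization.inr_star, star_star, hK.coe_mem_toIdeal] at h0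
  have hN : ∀ z ∈ N₂ A, z ∈ K := by
    intro z hz
    have hlim : Filter.Tendsto (fun n : ℕ => cut (1 / ((n : ℝ) + 1)) z) Filter.atTop (nhds z) := by
      rw [tendsto_iff_norm_sub_tendsto_zero]
      have h1 : Filter.Tendsto (fun n : ℕ => 2 * √(1 / ((n : ℝ) + 1))) Filter.atTop (nhds 0) := by
        have := (tendsto_one_div_add_atTop_nhds_zero_nat (𝕜 := ℝ)).sqrt.const_mul 2
        simpa using this
      refine squeeze_zero (fun n => norm_nonneg _) (fun n => ?_) h1
      rw [norm_sub_rev]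
      exact norm_sub_cut_le (by positivity) z
    exact (Submodule.isClosed_topologicalClosure _).mem_of_tendsto hlim
      (Filter.Eventually.of_forall fun n => hcut z hz _ (by positivity))
  by_cases hle : (isIdealSubspace_top (A := A)).toIdeal ≤ hK.toIdeal
  · intro a
    exact hK.coe_mem_toIdeal.1 (hle (isIdealSubspace_top.coe_mem_toIdeal.2 trivial))
  · exfalso
    obtain ⟨φ, _, ⟨a, -, rfl⟩, hφ⟩ := exists_algHom_ne_zero (P := isIdealSubspace_top.toIdeal) hI
      (by
        rintro _ ⟨a, -, rfl⟩ ha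
        refine hK.coe_mem_toIdeal.2 (hN a ?_)
        rw [← Unitization.inr_mul] at ha
        exact Unitization.inr_injective ha)
      (fun u => ⟨u.fst, (⟨u.snd, trivial, by
          rw [eq_sub_iff_add_eq, add_comm, Unitization.algebraMap_eq_inl]
          exact Unitization.inl_fst_add_inr_snd_eq u⟩ :
        _ ∈ (fun a : A => (a : Unitization ℂ A)) '' ((⊤ : Submodule ℂ A) : Set A))⟩) hle
    have _ := AlgHomClass.instStarHomClass (F := Unitization ℂ A →ₐ[ℂ] ℂ) (A := Unitization ℂ A)
    let π : A →⋆ₙₐ[ℂ] ℂ :=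
      { toFun := fun a => φ a
        map_smul' := fun k a => by simp
        map_zero' := by simp
        map_add' := fun a b => by simp
        map_mul' := fun a b => by simp
        map_star' := fun a => by rw [Unitization.inr_star, map_star] }
    exact hφ (DFunLike.congr_fun (hA π) a)

theorem pedersenIdeal_le_cutIdeal (hA : NoOneDimRep A) : pedersenIdeal A ≤ cutIdeal A :=
  sInf_le ⟨isIdealSubspace_cutIdeal, dense_cutIdeal hA⟩

end DenseIdeal

end CStarLie

theorem mainTheorem3 {A : Type*} [NonUnitalCStarAlgebra A] [PartialOrder A] [StarOrderedRing A]
    (hA : CStarLie.NoOneDimRep A) :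
    Submodule.span ℂ (CStarLie.SN₂c A) =
        CStarLie.commSpan (CStarLie.pedersenIdeal A : Set A) (CStarLie.pedersenIdeal A : Set A) ∧
      (CStarLie.HasUnit A →
        Submodule.span ℂ (CStarLie.N₂ A) =
            CStarLie.commSpan (Set.univ : Set A) (Set.univ : Set A) ∧
          ∃ K : ℕ, ∀ x y : A, ∃ n : ℕ, n ≤ K ∧ ∃ z : Fin n → A,
            (∀ i, z i ∈ CStarLie.N₂ A) ∧ x * y - y * x = ∑ i, z i) := by
  refine ⟨le_antisymm CStarLie.span_SN₂c_le (Submodule.span_le.2 ?_), ?_⟩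
  · rintro _ ⟨x, hx, y, -, rfl⟩
    exact CStarLie.commutator_mem_span_SN₂c (CStarLie.pedersenIdeal_le_cutIdeal hA hx) y
  · rintro ⟨u, hu⟩
    have hu' : u ∈ CStarLie.cutIdeal A := CStarLie.pedersenIdeal_le_cutIdeal hA
      (CStarLie.mem_pedersenIdeal_of_mul_eq (hu u).1)
    obtain ⟨K, hK⟩ := CStarLie.exists_sumOf_commutator_mul hu'
    have hK' : ∀ x y : A, CStarLie.SumOf (CStarLie.N₂ A) K (x * y - y * x) := fun x y => by
      have := (hK x y).mono_set CStarLie.SN₂c_subset_N₂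
      rwa [(hu x).1] at this
    refine ⟨le_antisymm (Submodule.span_le.2 fun z hz => ?_) (Submodule.span_le.2 ?_),
      K, fun x y => (hK' x y).exists_fin⟩
    · obtain ⟨y, s, h⟩ := CStarLie.exists_eq_commutator_of_mem_N₂ hz
      exact Submodule.subset_span ⟨y, trivial, s, trivial, h⟩
    · rintro _ ⟨x, -, y, -, rfl⟩
      exact (hK' x y).mem_span
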